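/- Let $\mathbb{D}$ be the open unit disk, let $dA=\pi^{-1}\,dx\,dy$, and let $\mathcal{D}$ be the Dirichlet space of analytic functions $f$ on $\mathbb{D}$ with $\|f\|_{\mathcal D}^2=|f(0)|^2+\int_{\mathbb D}|f'|^2\,dA<\infty$. For a sequence $c=\{c_n\}_{n\ge 0}$ of complex numbers, the Hankel type operator $\mathcal{H}_c$ acts on $f(z)=\sum_{k\ge 0}a_kz^k$ by $$\mathcal{H}_c(f)(z)=\sum_{n=0}^\infty\Big(\sum_{k=0}^\infty c_{n+k}a_k\Big)z^n,\qquad z\in\mathbb{D},$$ whenever the right-hand side makes sense and defines an analytic function on $\mathbb{D}$. It is said to be compact on $\mathcal{D}$ if it is defined on all of $\mathcal{D}$, maps $\mathcal{D}$ into $\mathcal{D}$, and is a (bounded) compact linear operator there. **Theorem 1.4.** Let $\{\lambda_n\}_{n\ge 0}$ be a sequence of complex numbers such that $h_\lambda(z)=\sum_{n=0}^\infty\lambda_nz^n$ converges on $\mathbb{D}$ and belongs to $\mathcal{D}$. Let $(X_n)_{n\ge 0}$ be independent identically distributed real random variables on a probability space with $\mathbb{E}[X_n]=0$ and $\mathbb{E}[X_n^4]<\infty$.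 Then almost surely the operator $\mathcal{H}_{\omega}$ with symbol sequence $\omega=\{X_n\overline{\lambda_n}\}_{n\ge 0}$ is compact on $\mathcal{D}$. -/

import Mathlib

open MeasureTheory ProbabilityTheory Filter Topology Metric
open scoped ComplexConjugate

noncomputable section

/-- The vector space of analytic functions on the open unit disk of `ℂ` with
`∫_𝔻 |f'|² dA < ∞`. A function on the disk is represented by its extension by zero to `ℂ`, so that
two elements are equal exactly when they agree on the disk. -/
def dirichletSubmodule : Submodule ℂ (ℂ → ℂ) where
  carrier := {f | DifferentiableOn ℂ f (ball 0 1) ∧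
    IntegrableOn (fun z => ‖deriv f z‖ ^ 2) (ball 0 1) ∧ ∀ z ∉ ball (0 : ℂ) 1, f z = 0}
  zero_mem' := by
    refine ⟨differentiableOn_const 0, ?_, fun _ _ => rfl⟩
    have h : (fun z : ℂ => ‖deriv (0 : ℂ → ℂ) z‖ ^ 2) = fun _ => 0 := by
      funext z
      simp
    rw [h]
    exact integrableOn_zero
  add_mem' := by
    rintro f g ⟨hf, hf', hf0⟩ ⟨hg, hg', hg0⟩
    refine ⟨hf.add hg, ?_, fun z hz => by simp [hf0 z hz, hg0 z hz]⟩
    have mf := (memLp_two_iff_integrable_sq_norm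
      (measurable_deriv f).aestronglyMeasurable).2 hf'
    have mg := (memLp_two_iff_integrable_sq_norm
      (measurable_deriv g).aestronglyMeasurable).2 hg'
    refine ((mf.add mg).integrable_norm_pow two_ne_zero).congr ?_
    filter_upwards [ae_restrict_mem measurableSet_ball] with z hz
    rw [deriv_add (hf.differentiableAt (isOpen_ball.mem_nhds hz))
      (hg.differentiableAt (isOpen_ball.mem_nhds hz))]
    rfl
  smul_mem' := by
    rintro c f ⟨hf, hf', hf0⟩
    refine ⟨hf.const_smul c, ?_, fun z hz => by simp [hf0 z hz]⟩
    refine (hf'.const_mul (‖c‖ ^ 2)).congr ?_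
    filter_upwards [ae_restrict_mem measurableSet_ball] with z hz
    rw [deriv_const_smul c (hf.differentiableAt (isOpen_ball.mem_nhds hz)), norm_smul, mul_pow]

/-- The Dirichlet space `𝓓` of the unit disk. -/
def DirichletSpace : Type := dirichletSubmodule

namespace DirichletSpace

instance : AddCommGroup DirichletSpace := inferInstanceAs (AddCommGroup dirichletSubmodule)

instance : Module ℂ DirichletSpace := inferInstanceAs (Module ℂ dirichletSubmodule)

instance : CoeFun DirichletSpace (fun _ => ℂ → ℂ) := ⟨fun f => f.1⟩

theorem differentiableAt (f : DirichletSpace) {z : ℂ} (hz : z ∈ ball (0 : ℂ) 1) :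
    DifferentiableAt ℂ f z :=
  f.2.1.differentiableAt (isOpen_ball.mem_nhds hz)

theorem memLp_deriv (f : DirichletSpace) :
    MemLp (deriv f) 2 (volume.restrict (ball (0 : ℂ) 1)) :=
  (memLp_two_iff_integrable_sq_norm (measurable_deriv f.1).aestronglyMeasurable).2 f.2.2.1

theorem integrable_inner (f g : DirichletSpace) :
    IntegrableOn (fun z => conj (deriv f z) * deriv g z) (ball (0 : ℂ) 1) :=
  f.memLp_deriv.star.integrable_mul g.memLp_deriv

/-- The Dirichlet inner product
`⟪f, g⟫ = conj (f 0) * g 0 + ∫_𝔻 conj (f' z) * g' z dA(z)`, where `dA = π⁻¹ dx dy`.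
As everywhere in Mathlib, it is conjugate-linear in the first variable. -/
@[reducible] def core : InnerProductSpace.Core ℂ DirichletSpace where
  inner f g := conj (f 0) * g 0 +
    (Real.pi : ℂ)⁻¹ * ∫ z in ball (0 : ℂ) 1, conj (deriv f z) * deriv g z
  conj_inner_symm f g := by
    simp only [map_add, map_mul, Complex.conj_conj, map_inv₀, Complex.conj_ofReal,
      ← integral_conj]
    simp only [mul_comm]
  re_inner_nonneg f := by
    have h : (conj (f 0) * f 0 + (Real.pi : ℂ)⁻¹ *
        ∫ z in ball (0 : ℂ) 1, conj (deriv f z) * deriv f z) =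
        ((‖f 0‖ ^ 2 + Real.pi⁻¹ * ∫ z in ball (0 : ℂ) 1, ‖deriv f z‖ ^ 2 : ℝ) : ℂ) := by
      push_cast [← integral_complex_ofReal]
      simp only [Complex.conj_mul']
    change 0 ≤ RCLike.re (conj (f 0) * f 0 + (Real.pi : ℂ)⁻¹ *
        ∫ z in ball (0 : ℂ) 1, conj (deriv f z) * deriv f z)
    rw [h]
    have : 0 ≤ ∫ z in ball (0 : ℂ) 1, ‖deriv f z‖ ^ 2 := integral_nonneg fun _ => by positivity
    simp only [RCLike.re_to_complex, Complex.ofReal_re]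
    positivity
  add_left f g k := by
    have h : ∫ z in ball (0 : ℂ) 1, conj (deriv (f + g : DirichletSpace) z) * deriv k z =
        (∫ z in ball (0 : ℂ) 1, conj (deriv f z) * deriv k z) +
          ∫ z in ball (0 : ℂ) 1, conj (deriv g z) * deriv k z := by
      rw [← integral_add (integrable_inner f k) (integrable_inner g k)]
      refine setIntegral_congr_fun measurableSet_ball fun z hz => ?_
      have := deriv_add (f.differentiableAt hz) (g.differentiableAt hz)
      change conj (deriv (f.1 + g.1) z) * _ = _
      rw [this, map_add, add_mul]
    have h0 : (f + g : DirichletSpace) 0 = f 0 + g 0 := rfl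
    rw [h, h0, map_add]
    ring
  smul_left f g r := by
    have h : ∫ z in ball (0 : ℂ) 1, conj (deriv (r • f : DirichletSpace) z) * deriv g z =
        conj r * ∫ z in ball (0 : ℂ) 1, conj (deriv f z) * deriv g z := by
      rw [← integral_const_mul]
      refine setIntegral_congr_fun measurableSet_ball fun z hz => ?_
      have := deriv_const_smul r (f.differentiableAt hz)
      change conj (deriv (r • f.1) z) * _ = _
      rw [this, smul_eq_mul, map_mul, mul_assoc]
    have h0 : (r • f : DirichletSpace) 0 = r * f 0 := rfl
    rw [h, h0, map_mul]
    ring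
  definite f hf := by
    have h : (conj (f 0) * f 0 + (Real.pi : ℂ)⁻¹ *
        ∫ z in ball (0 : ℂ) 1, conj (deriv f z) * deriv f z) =
        ((‖f 0‖ ^ 2 + Real.pi⁻¹ * ∫ z in ball (0 : ℂ) 1, ‖deriv f z‖ ^ 2 : ℝ) : ℂ) := by
      push_cast [← integral_complex_ofReal]
      simp only [Complex.conj_mul']
    rw [h, Complex.ofReal_eq_zero] at hf
    have hI : 0 ≤ ∫ z in ball (0 : ℂ) 1, ‖deriv f z‖ ^ 2 := integral_nonneg fun _ => by positivity
    have hpi : 0 < Real.pi⁻¹ := inv_pos.2 Real.pi_pos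
    have hf0 : f 0 = 0 := by
      have : ‖f 0‖ ^ 2 = 0 := by nlinarith [sq_nonneg ‖f 0‖, mul_nonneg hpi.le hI]
      simpa using this
    have hI0 : ∫ z in ball (0 : ℂ) 1, ‖deriv f z‖ ^ 2 = 0 := by
      have : Real.pi⁻¹ * ∫ z in ball (0 : ℂ) 1, ‖deriv f z‖ ^ 2 = 0 := by
        nlinarith [sq_nonneg ‖f 0‖, mul_nonneg hpi.le hI]
      exact (mul_eq_zero.1 this).resolve_left hpi.ne'
    have hae : (deriv f.1) =ᵐ[volume.restrict (ball (0 : ℂ) 1)] fun _ => (0 : ℂ) := by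
      have := (integral_eq_zero_iff_of_nonneg (fun _ => by positivity) f.2.2.1).1 hI0
      filter_upwards [this] with z hz
      simpa using hz
    have hEq : Set.EqOn (deriv f.1) (fun _ => (0 : ℂ)) (ball 0 1) :=
      Measure.eqOn_open_of_ae_eq hae isOpen_ball
        (f.2.1.deriv isOpen_ball).continuousOn continuousOn_const
    apply Subtype.ext
    funext z
    by_cases hz : z ∈ ball (0 : ℂ) 1
    · have := isOpen_ball.is_const_of_deriv_eq_zero (convex_ball (0 : ℂ) 1).isPreconnected f.2.1
        hEq hz (mem_ball_self one_pos)
      exact this.trans hf0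
    · exact f.2.2.2 z hz

instance : NormedAddCommGroup DirichletSpace := core.toNormedAddCommGroup

instance : InnerProductSpace ℂ DirichletSpace := InnerProductSpace.ofCore core.toCore

theorem norm_sq_eq (f : DirichletSpace) :
    ‖f‖ ^ 2 = ‖f 0‖ ^ 2 + Real.pi⁻¹ * ∫ z in ball (0 : ℂ) 1, ‖deriv f z‖ ^ 2 := by
  have h : inner ℂ f f =
      ((‖f 0‖ ^ 2 + Real.pi⁻¹ * ∫ z in ball (0 : ℂ) 1, ‖deriv f z‖ ^ 2 : ℝ) : ℂ) := by
    change conj (f 0) * f 0 + (Real.pi : ℂ)⁻¹ *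
      ∫ z in ball (0 : ℂ) 1, conj (deriv f z) * deriv f z = _
    push_cast [← integral_complex_ofReal]
    simp only [Complex.conj_mul']
  rw [← inner_self_eq_norm_sq (𝕜 := ℂ) f, h]
  simp only [RCLike.re_to_complex, Complex.ofReal_re]

end DirichletSpace

/-- The `k`-th Taylor coefficient of `f` at the origin. -/
def taylorCoeffZero (f : ℂ → ℂ) (k : ℕ) : ℂ := iteratedDeriv k f 0 / (k.factorial : ℂ)

/-- The Hankel matrix `(c (j + k))` acts on the analytic function `f(z) = ∑ aₖ zᵏ`, and the result
is the analytic function `g`: each series `bₙ = ∑ₖ c (n + k) aₖ` converges (as the limit of its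
partial sums), and the power series `∑ bₙ zⁿ` converges to `g z` at every point `z` of the disk. -/
def IsHankelImage (c : ℕ → ℂ) (f g : ℂ → ℂ) : Prop :=
  ∃ b : ℕ → ℂ,
    (∀ n, Tendsto (fun N => ∑ k ∈ Finset.range N, c (n + k) * taylorCoeffZero f k)
      atTop (𝓝 (b n))) ∧
    ∀ z ∈ ball (0 : ℂ) 1, HasSum (fun n => b n * z ^ n) (g z)

/-- The Hankel type operator with symbol sequence `c` is defined on all of the Dirichlet space,
maps it to itself, and is a (bounded and) compact operator on it. -/
def HankelCompactOnDirichlet (c : ℕ → ℂ) : Prop :=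
  ∃ T : DirichletSpace →L[ℂ] DirichletSpace,
    (∀ f : DirichletSpace, IsHankelImage c f (T f)) ∧ IsCompactOperator T

/-- The power series `∑ aₙ zⁿ` converges on the unit disk and its sum belongs to the
Dirichlet space. -/
def PowerSeriesMemDirichlet (a : ℕ → ℂ) : Prop :=
  ∃ h : DirichletSpace, ∀ z ∈ ball (0 : ℂ) 1, HasSum (fun n => a n * z ^ n) (h z)

end

/-!
In the orthonormal basis of normalized monomials the Dirichlet space is `ℓ²`
(`DirichletSpace.equivLp`), and the Hankel operator with symbol sequence `c` has the matrix
`√(W n / W k) c (n + k)`, where `W n = max n 1`. Let `wₖ` be its columns. The operator is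
`b ↦ ∑ bₖ wₖ`, and it is compact as soon as its Gram matrix `⟪wⱼ, wₖ⟫` is the sum of a diagonal
matrix with entries tending to zero and a Hilbert–Schmidt matrix
(`exists_isCompactOperator_of_gram`).

The diagonal entry `‖wₖ‖²` is at most `(∑ W n |c n|²) / W k`, so it tends to zero whenever the symbol
is in the Dirichlet space, which is almost surely the case for `c n = X n * conj (l n)`. The
randomness is needed off the diagonal only. There
`⟪wⱼ, wₖ⟫ = (W j W k)^(-1/2) ∑ₙ W n l (n + j) conj (l (n + k)) X (n + j) X (n + k)`,
and for `j ≠ k` the products `X (n + j) X (n + k)`, `n = 0, 1, 2, …`, are orthogonal in `L²`, since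
among the indices of two of them the smallest one occurs only once
(`integral_shift_mul_shift_eq_zero`). Therefore, with `u m = W m |l m|²`,
`𝔼 |⟪wⱼ, wₖ⟫|² ≤ 𝔼 [X 0 ^ 4] ∑ₙ u (n + j) u (n + k) (W j ^ (-2) + W k ^ (-2))`,
and the sum over `j` and `k` is at most `2 𝔼 [X 0 ^ 4] (∑ u)² ∑ W j ^ (-2) < ∞`. Hence the
off-diagonal part is almost surely Hilbert–Schmidt (`ae_tsum_gram_ne_top`).
-/

/-! ### Area integrals of power series on the disk -/

theorem integral_exp_natCast_sub_mul_I (m n : ℕ) :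
    ∫ t in Set.Ioo (-Real.pi) Real.pi, Complex.exp (((m : ℂ) - n) * Complex.I * t) =
      if m = n then 2 * (Real.pi : ℂ) else 0 := by
  rw [← integral_Ioc_eq_integral_Ioo, ← intervalIntegral.integral_of_le (by linarith [Real.pi_pos])]
  split_ifs with h
  · subst h
    simp
    ring
  · have h' : ((m : ℂ) - n) * Complex.I ≠ 0 :=
      mul_ne_zero (sub_ne_zero.2 (by exact_mod_cast h)) Complex.I_ne_zero
    rw [integral_exp_mul_complex h', div_eq_zero_iff]
    left
    rw [sub_eq_zero, Complex.exp_eq_exp_iff_exists_int]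
    refine ⟨(m : ℤ) - n, ?_⟩
    push_cast
    ring

theorem hasSum_mul_conj {a : ℕ → ℂ} (h : Summable fun n => ‖a n‖) :
    HasSum (fun p : ℕ × ℕ => a p.1 * conj (a p.2)) ((‖∑' n, a n‖ ^ 2 : ℝ) : ℂ) := by
  have h' : Summable fun n => ‖conj (a n)‖ := by simpa only [RCLike.norm_conj] using h
  rw [Complex.ofReal_pow, ← Complex.mul_conj']
  have h1 : HasSum a (∑' n, a n) := h.of_norm.hasSum
  have h2 : HasSum (fun n => conj (a n)) (conj (∑' n, a n)) := Complex.hasSum_conj'.2 h1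
  have h3 : Summable fun p : ℕ × ℕ => a p.1 * conj (a p.2) :=
    summable_mul_of_summable_norm (f := a) (g := fun n => conj (a n)) h h'
  exact HasSum.mul (f := a) (g := fun n => conj (a n)) h1 h2 h3

/-- Parseval's identity on the unit circle for absolutely convergent power series. -/
theorem lintegral_enorm_sq_circle (c : ℕ → ℂ) (hc : Summable fun n => ‖c n‖) :
    ∫⁻ t in Set.Ioo (-Real.pi) Real.pi, ‖∑' n, c n * Complex.exp (t * Complex.I) ^ n‖ₑ ^ 2 =
      ∑' n, ENNReal.ofReal (2 * Real.pi * ‖c n‖ ^ 2) := by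
  set μ : Measure ℝ := volume.restrict (Set.Ioo (-Real.pi) Real.pi) with hμ
  have hnorm : ∀ (n : ℕ) (t : ℝ), ‖Complex.exp (t * Complex.I) ^ n‖ = 1 := fun n t => by
    rw [norm_pow, Complex.norm_exp_ofReal_mul_I, one_pow]
  have hs : ∀ t : ℝ, Summable fun n => ‖c n * Complex.exp (t * Complex.I) ^ n‖ := fun t => by
    simpa only [norm_mul, hnorm, mul_one] using hc
  obtain ⟨F, hF⟩ : ∃ F : ℕ × ℕ → ℝ → ℂ, ∀ p t, F p t =
      c p.1 * conj (c p.2) * Complex.exp (((p.1 : ℂ) - p.2) * Complex.I * t) :=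
    ⟨_, fun _ _ => rfl⟩
  have hFn : ∀ p t, ‖F p t‖ = ‖c p.1‖ * ‖c p.2‖ := fun p t => by
    have : ((p.1 : ℂ) - p.2) * Complex.I * t = (((p.1 : ℝ) - p.2) * t : ℝ) * Complex.I := by
      push_cast; ring
    simp only [hF, norm_mul, RCLike.norm_conj, this, Complex.norm_exp_ofReal_mul_I, mul_one]
  have hFi : ∀ p, Integrable (F p) μ := fun p => by
    have h : Continuous (F p) := by
      rw [funext (hF p)]
      fun_prop
    exact h.integrableOn_Icc.mono_set Set.Ioo_subset_Icc_self
  have hsum2 : Summable fun p : ℕ × ℕ => ‖c p.1‖ * ‖c p.2‖ :=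
    Summable.mul_of_nonneg (f := fun n => ‖c n‖) (g := fun n => ‖c n‖) hc hc
      (fun n => norm_nonneg (c n)) fun n => norm_nonneg (c n)
  have key := hasSum_integral_of_summable_integral_norm (F := F) (μ := μ) hFi (by
    simp only [hFn, integral_const]
    exact hsum2.const_smul _)
  have hFsum : ∀ t : ℝ, ∑' p, F p t =
      ((‖∑' n, c n * Complex.exp (t * Complex.I) ^ n‖ ^ 2 : ℝ) : ℂ) := fun t => by
    rw [← (hasSum_mul_conj (hs t)).tsum_eq]
    refine tsum_congr fun p => ?_
    simp only [hF, map_mul, ← Complex.exp_conj, Complex.conj_ofReal, Complex.conj_I, map_natCast,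
      ← Complex.exp_nat_mul]
    rw [mul_mul_mul_comm (c p.1) (Complex.exp _), ← Complex.exp_add]
    congr 2
    ring
  have hint : ∀ p, ∫ t, F p t ∂μ =
      if p.1 = p.2 then ((2 * Real.pi * ‖c p.1‖ ^ 2 : ℝ) : ℂ) else 0 := fun p => by
    simp only [hF]
    rw [integral_const_mul, hμ, integral_exp_natCast_sub_mul_I]
    split_ifs with h
    · rw [← h, Complex.mul_conj']
      push_cast
      ring
    · simp
  simp only [hint, hFsum] at key
  rw [integral_complex_ofReal] at key
  have hinj : Function.Injective fun n : ℕ => (n, n) := fun a b h => (Prod.mk.inj h).1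
  -- only the diagonal of the double series survives the integration
  rw [← hinj.hasSum_iff (by
    rintro ⟨a, b⟩ h
    have : a ≠ b := by rintro rfl; exact h ⟨a, rfl⟩
    simp [this])] at key
  simp only [Function.comp_def, if_true, Complex.hasSum_ofReal] at key
  have hcont : Continuous fun t : ℝ => ∑' n, c n * Complex.exp (t * Complex.I) ^ n :=
    continuous_tsum (fun n => by fun_prop) hc fun n t => by rw [norm_mul, hnorm, mul_one]
  have hgi : Integrable (fun t : ℝ => ‖∑' n, c n * Complex.exp (t * Complex.I) ^ n‖ ^ 2) μ :=
    (hcont.norm.pow 2).integrableOn_Icc.mono_set Set.Ioo_subset_Icc_self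
  rw [← ENNReal.ofReal_tsum_of_nonneg (fun n => by positivity) key.summable, key.tsum_eq,
    ofReal_integral_eq_lintegral_ofReal hgi (ae_of_all _ fun t => by positivity)]
  refine lintegral_congr fun t => ?_
  rw [ENNReal.ofReal_pow (norm_nonneg _), ofReal_norm]

/-- The area integral of `|g|²` for `g(z) = ∑ dₙ zⁿ` is `π ∑ |dₙ|² / (n + 1)`: Parseval's identity
on each circle, integrated in polar coordinates. In `ℝ≥0∞` no finiteness is assumed, so that the
same identity shows that a series with finite right-hand side has finite area integral. -/
theorem lintegral_enorm_sq_ball {g : ℂ → ℂ} (hg : Measurable g) (d : ℕ → ℂ)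
    (h : ∀ z ∈ ball (0 : ℂ) 1, HasSum (fun n => d n * z ^ n) (g z)) :
    ∫⁻ z in ball (0 : ℂ) 1, ‖g z‖ₑ ^ 2 =
      ∑' n, ENNReal.ofReal (Real.pi * (‖d n‖ ^ 2 / (n + 1))) := by
  have hcirc : ∀ r ∈ Set.Ioo (0 : ℝ) 1, ∫⁻ t in Set.Ioo (-Real.pi) Real.pi,
      ‖g (Complex.polarCoord.symm (r, t))‖ₑ ^ 2 =
        ∑' n, ENNReal.ofReal (2 * Real.pi * (‖d n‖ ^ 2 * r ^ (2 * n))) := fun r hr => by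
    have hmem : ∀ t : ℝ, (r : ℂ) * Complex.exp (t * Complex.I) ∈ ball (0 : ℂ) 1 := fun t => by
      simp [abs_of_pos hr.1, hr.2, Complex.norm_exp_ofReal_mul_I]
    have hsum : Summable fun n => ‖d n * (r : ℂ) ^ n‖ :=
      (h (r : ℂ) (by simpa [abs_of_pos hr.1] using hr.2)).summable.norm
    have := lintegral_enorm_sq_circle (fun n => d n * (r : ℂ) ^ n) hsum
    convert this using 2
    · funext t
      rw [Complex.polarCoord_symm_apply, Complex.ofReal_cos, Complex.ofReal_sin,
        ← Complex.exp_mul_I, ← (h _ (hmem t)).tsum_eq]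
      simp only [mul_pow, mul_assoc]
    · funext n
      rw [norm_mul, norm_pow, Complex.norm_real, Real.norm_of_nonneg hr.1.le, mul_pow, ← pow_mul,
        mul_comm n 2]
  have hmeas : Measurable fun p : ℝ × ℝ => ‖g (Complex.polarCoord.symm p)‖ₑ ^ 2 := by
    have : Measurable fun p : ℝ × ℝ => Complex.polarCoord.symm p := by
      simp only [Complex.polarCoord_symm_apply]
      fun_prop
    exact ((hg.comp this).enorm).pow_const 2
  calc ∫⁻ z in ball (0 : ℂ) 1, ‖g z‖ₑ ^ 2
      = ∫⁻ z, (ball (0 : ℂ) 1).indicator (fun z => ‖g z‖ₑ ^ 2) z :=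
        (lintegral_indicator measurableSet_ball _).symm
    _ = ∫⁻ p in Set.Ioi (0 : ℝ) ×ˢ Set.Ioo (-Real.pi) Real.pi,
          (Set.Iio (1 : ℝ)).indicator (fun r => ENNReal.ofReal r) p.1 *
            ‖g (Complex.polarCoord.symm p)‖ₑ ^ 2 := by
        rw [← Complex.lintegral_comp_polarCoord_symm, polarCoord_target]
        refine setLIntegral_congr_fun (measurableSet_Ioi.prod measurableSet_Ioo) fun p hp => ?_
        have hp1 : 0 < p.1 := hp.1
        have : Complex.polarCoord.symm p ∈ ball (0 : ℂ) 1 ↔ p.1 < 1 := by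
          rw [mem_ball_zero_iff, Complex.norm_polarCoord_symm, abs_of_pos hp1]
        by_cases hlt : p.1 < 1
        · rw [Set.indicator_of_mem (this.2 hlt), Set.indicator_of_mem (Set.mem_Iio.2 hlt), smul_eq_mul]
        · rw [Set.indicator_of_notMem (mt this.1 hlt), Set.indicator_of_notMem (by simpa using hlt),
            smul_zero, zero_mul]
    _ = ∫⁻ r in Set.Ioi (0 : ℝ), ∫⁻ t in Set.Ioo (-Real.pi) Real.pi,
          (Set.Iio (1 : ℝ)).indicator (fun r => ENNReal.ofReal r) r *
            ‖g (Complex.polarCoord.symm (r, t))‖ₑ ^ 2 := by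
        rw [Measure.volume_eq_prod, ← Measure.prod_restrict, lintegral_prod]
        refine AEMeasurable.mul (Measurable.aemeasurable ?_) hmeas.aemeasurable
        exact (ENNReal.measurable_ofReal.indicator measurableSet_Iio).comp measurable_fst
    _ = ∫⁻ r in Set.Ioi (0 : ℝ), (Set.Iio (1 : ℝ)).indicator
          (fun r => ∑' n, ENNReal.ofReal (2 * Real.pi * ‖d n‖ ^ 2 * r ^ (2 * n + 1))) r := by
        refine setLIntegral_congr_fun measurableSet_Ioi fun r hr => ?_
        have hr0 : (0 : ℝ) < r := hr
        by_cases hlt : r < 1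
        · simp only [Set.indicator, Set.mem_Iio, hlt, if_true]
          have hm : Measurable fun t : ℝ => ‖g (Complex.polarCoord.symm (r, t))‖ₑ ^ 2 :=
            hmeas.comp measurable_prodMk_left
          rw [lintegral_const_mul _ hm, hcirc r ⟨hr0, hlt⟩,
            ← ENNReal.tsum_mul_left]
          refine tsum_congr fun n => ?_
          rw [← ENNReal.ofReal_mul hr0.le]
          ring_nf
        · simp [Set.indicator, hlt]
    _ = ∫⁻ r in Set.Ioo (0 : ℝ) 1,
          ∑' n, ENNReal.ofReal (2 * Real.pi * ‖d n‖ ^ 2 * r ^ (2 * n + 1)) := by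
        rw [lintegral_indicator measurableSet_Iio, Measure.restrict_restrict measurableSet_Iio,
          Set.inter_comm, Set.Ioi_inter_Iio]
    _ = ∑' n, ∫⁻ r in Set.Ioo (0 : ℝ) 1,
          ENNReal.ofReal (2 * Real.pi * ‖d n‖ ^ 2 * r ^ (2 * n + 1)) :=
        lintegral_tsum fun n => by fun_prop
    _ = ∑' n, ENNReal.ofReal (Real.pi * (‖d n‖ ^ 2 / (n + 1))) := by
        refine tsum_congr fun n => ?_
        rw [← ofReal_integral_eq_lintegral_ofReal, ← integral_Ioc_eq_integral_Ioo,
          ← intervalIntegral.integral_of_le zero_le_one, intervalIntegral.integral_const_mul,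
          integral_pow]
        · congr 1
          push_cast
          field_simp
          ring
        · exact (Continuous.integrableOn_Icc (by fun_prop)).mono_set Set.Ioo_subset_Icc_self
        · filter_upwards [ae_restrict_mem measurableSet_Ioo] with r hr
          have := hr.1
          positivity

/-! ### Compactness from the Gram matrix -/

section Gram

variable {H : Type*} [NormedAddCommGroup H] [InnerProductSpace ℂ H]

/-- Bound for a linear combination by its Gram matrix: the diagonal part is bounded by its largest
entry, the off-diagonal part by its Hilbert–Schmidt norm. -/
theorem norm_sum_smul_sq_le (w : ℕ → H) (b : ℕ → ℂ) (t : Finset ℕ) {ε δ : ℝ} (hδ : 0 ≤ δ)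
    (hdiag : ∀ k ∈ t, ‖w k‖ ^ 2 ≤ ε)
    (hoff : ∑ p ∈ t.offDiag, ‖inner ℂ (w p.1) (w p.2)‖ ^ 2 ≤ δ ^ 2) :
    ‖∑ k ∈ t, b k • w k‖ ^ 2 ≤ (ε + δ) * ∑ k ∈ t, ‖b k‖ ^ 2 := by
  have h1 : ‖∑ k ∈ t, b k • w k‖ ^ 2 ≤
      ∑ p ∈ t ×ˢ t, ‖b p.1‖ * ‖b p.2‖ * ‖inner ℂ (w p.1) (w p.2)‖ := by
    have : ‖∑ k ∈ t, b k • w k‖ ^ 2 = ‖inner ℂ (∑ k ∈ t, b k • w k) (∑ k ∈ t, b k • w k)‖ := by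
      rw [inner_self_eq_norm_sq_to_K]
      simp
    rw [this, Finset.sum_product]
    simp only [sum_inner, inner_sum]
    refine (norm_sum_le _ _).trans (Finset.sum_le_sum fun j _ => ?_)
    refine (norm_sum_le _ _).trans (Finset.sum_le_sum fun k _ => le_of_eq ?_)
    rw [inner_smul_left, inner_smul_right, norm_mul, norm_mul, RCLike.norm_conj, mul_left_comm, mul_assoc,
      norm_inner_symm (w j)]
  have h2 : ∑ p ∈ t.offDiag, ‖b p.1‖ * ‖b p.2‖ * ‖inner ℂ (w p.1) (w p.2)‖ ≤
      δ * ∑ k ∈ t, ‖b k‖ ^ 2 := by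
    refine abs_le_of_sq_le_sq' ?_ (by positivity) |>.2
    refine (Finset.sum_mul_sq_le_sq_mul_sq _ _ _).trans ?_
    rw [mul_pow, mul_comm (δ ^ 2)]
    refine mul_le_mul ?_ hoff (Finset.sum_nonneg fun _ _ => by positivity) (by positivity)
    calc ∑ p ∈ t.offDiag, (‖b p.1‖ * ‖b p.2‖) ^ 2
        ≤ ∑ p ∈ t ×ˢ t, (‖b p.1‖ * ‖b p.2‖) ^ 2 :=
          Finset.sum_le_sum_of_subset_of_nonneg
            (fun p hp => by simp only [Finset.mem_offDiag] at hp; simp [hp.1, hp.2.1])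
            fun _ _ _ => by positivity
      _ = (∑ k ∈ t, ‖b k‖ ^ 2) ^ 2 := by
          simp only [mul_pow]
          rw [sq (∑ k ∈ t, ‖b k‖ ^ 2), Finset.sum_mul_sum, Finset.sum_product]
  have h3 : ∑ p ∈ t.diag, ‖b p.1‖ * ‖b p.2‖ * ‖inner ℂ (w p.1) (w p.2)‖ ≤
      ε * ∑ k ∈ t, ‖b k‖ ^ 2 := by
    rw [Finset.sum_diag, Finset.mul_sum]
    refine Finset.sum_le_sum fun k hk => ?_
    have : ‖inner ℂ (w k) (w k)‖ = ‖w k‖ ^ 2 := by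
      rw [inner_self_eq_norm_sq_to_K]
      simp
    rw [this, ← sq, mul_comm ε]
    exact mul_le_mul_of_nonneg_left (hdiag k hk) (by positivity)
  rw [← Finset.diag_union_offDiag, Finset.sum_union (Finset.disjoint_diag_offDiag t)] at h1
  linarith [add_mul ε δ (∑ k ∈ t, ‖b k‖ ^ 2)]

/-- If the Gram matrix of the vectors `wₖ` is the sum of a diagonal matrix with entries tending to
zero and a Hilbert–Schmidt matrix, then `b ↦ ∑ bₖ wₖ` is a compact operator on `ℓ²`. The series of
the rank one operators `b ↦ bₖ wₖ` converges in operator norm. -/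
theorem exists_isCompactOperator_of_gram [CompleteSpace H] (w : ℕ → H)
    (hdiag : Tendsto (fun k => ‖w k‖) atTop (𝓝 0))
    (hoff : Summable fun p : ℕ × ℕ => if p.1 = p.2 then 0 else ‖inner ℂ (w p.1) (w p.2)‖ ^ 2) :
    ∃ S : lp (fun _ : ℕ => ℂ) 2 →L[ℂ] H, IsCompactOperator S ∧
      ∀ b : lp (fun _ : ℕ => ℂ) 2, HasSum (fun k => b k • w k) (S b) := by
  let A : ℕ → lp (fun _ : ℕ => ℂ) 2 →L[ℂ] H := fun k =>
    (lp.evalCLM ℂ (fun _ : ℕ => ℂ) 2 k).smulRight (w k)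
  have hA : ∀ k (b : lp (fun _ : ℕ => ℂ) 2), A k b = b k • w k := fun k b => rfl
  have hAc : ∀ k, IsCompactOperator (A k) := fun k =>
    (isCompactOperator_of_locallyCompactSpace_dom
      (lp.evalCLM ℂ (fun _ : ℕ => ℂ) 2 k)).clm_comp (ContinuousLinearMap.toSpanSingleton ℂ (w k))
  have hsum : Summable A := by
    rw [summable_iff_vanishing_norm]
    intro ε hε
    obtain ⟨s, hs⟩ := summable_iff_vanishing_norm.1 hoff ((ε ^ 2 / 8) ^ 2) (by positivity)
    obtain ⟨N, hN⟩ := (hdiag.eventually (gt_mem_nhds (show 0 < ε / 4 by positivity))).exists_forall_of_atTop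
    refine ⟨Finset.range N ∪ s.image Prod.fst, fun t ht => ?_⟩
    refine lt_of_le_of_lt ?_ (half_lt_self hε)
    refine ContinuousLinearMap.opNorm_le_bound _ (by positivity) fun b => ?_
    rw [Finset.disjoint_union_right] at ht
    have hb : ∑ k ∈ t, ‖b k‖ ^ 2 ≤ ‖b‖ ^ 2 := by
      have := lp.sum_rpow_le_norm_rpow (p := 2) (by norm_num) b t
      simpa using this
    have := norm_sum_smul_sq_le w b t (ε := ε ^ 2 / 8) (δ := ε ^ 2 / 8) (by positivity)
      (fun k hk => by
        have : N ≤ k := by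
          by_contra hlt
          exact Finset.disjoint_left.1 ht.1 hk (Finset.mem_range.2 (not_le.1 hlt))
        nlinarith [hN k this, norm_nonneg (w k)])
      (by
        have hd : Disjoint t.offDiag s := Finset.disjoint_left.2 fun p hp hps =>
          Finset.disjoint_left.1 ht.2 (Finset.mem_offDiag.1 hp).1 (Finset.mem_image_of_mem _ hps)
        refine le_trans (le_of_eq ?_) ((le_abs_self _).trans (hs _ hd).le)
        exact Finset.sum_congr rfl fun p hp => (if_neg (Finset.mem_offDiag.1 hp).2.2).symm)
    simp only [_root_.sum_apply, hA]
    refine abs_le_of_sq_le_sq' ?_ (by positivity) |>.2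
    nlinarith [this, hb, sq_nonneg ε]
  refine ⟨∑' k, A k, ?_, fun b => ?_⟩
  · exact isCompactOperator_of_tendsto hsum.hasSum (Eventually.of_forall fun t => by
      induction t using Finset.induction_on with
      | empty => exact isCompactOperator_zero
      | insert a t ha ih => rw [Finset.sum_insert ha]; exact (hAc a).add ih)
  · exact hsum.hasSum.mapL (ContinuousLinearMap.apply ℂ H b)

end Gram

/-! ### The Dirichlet space as a weighted sequence space -/

/-- The weight `max n 1`, for which `‖f‖² = ∑ (max n 1) |aₙ|²` for `f(z) = ∑ aₙ zⁿ` in the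
Dirichlet space. The value `1` at `n = 0` accounts for the term `|f 0|²` of the norm. -/
noncomputable def dirichletWeight (n : ℕ) : ℝ := max n 1

theorem one_le_dirichletWeight (n : ℕ) : 1 ≤ dirichletWeight n := le_max_right _ _

theorem dirichletWeight_pos (n : ℕ) : 0 < dirichletWeight n :=
  zero_lt_one.trans_le (one_le_dirichletWeight n)

theorem dirichletWeight_mono : Monotone dirichletWeight := fun _ _ h =>
  max_le_max_right 1 (Nat.cast_le.2 h)

theorem norm_sqrt_dirichletWeight_mul_sq (n : ℕ) (a : ℂ) :
    ‖(Real.sqrt (dirichletWeight n) : ℂ) * a‖ ^ 2 = dirichletWeight n * ‖a‖ ^ 2 := by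
  rw [norm_mul, mul_pow, Complex.norm_real, Real.norm_of_nonneg (Real.sqrt_nonneg _),
    Real.sq_sqrt (dirichletWeight_pos n).le]

theorem lp_two_norm_sq_eq_tsum (b : lp (fun _ : ℕ => ℂ) 2) : ‖b‖ ^ 2 = ∑' n, ‖b n‖ ^ 2 := by
  simpa using lp.norm_rpow_eq_tsum (p := 2) (by norm_num) b

theorem hasFPowerSeriesOnBall_ofScalars {g : ℂ → ℂ} {b : ℕ → ℂ}
    (h : ∀ z ∈ ball (0 : ℂ) 1, HasSum (fun n => b n * z ^ n) (g z)) :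
    HasFPowerSeriesOnBall g (FormalMultilinearSeries.ofScalars ℂ b) 0 1 := by
  refine ⟨ENNReal.le_of_forall_nnreal_lt fun r hr => ?_, one_pos, fun {y} hy => ?_⟩
  · have hr1 : (r : ℝ) < 1 := by exact_mod_cast hr
    refine FormalMultilinearSeries.le_radius_of_summable_norm _ ?_
    have := (h (r : ℝ) (by simpa using hr1)).summable.norm
    simpa using this
  · have hy' : y ∈ ball (0 : ℂ) 1 := by
      rwa [← Metric.eball_ofReal, ENNReal.ofReal_one]
    simpa [FormalMultilinearSeries.ofScalars_apply_eq, mul_comm] using h y hy'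

theorem taylorCoeffZero_eq_of_hasSum {g : ℂ → ℂ} {b : ℕ → ℂ}
    (h : ∀ z ∈ ball (0 : ℂ) 1, HasSum (fun n => b n * z ^ n) (g z)) (n : ℕ) :
    taylorCoeffZero g n = b n := by
  have hp := (hasFPowerSeriesOnBall_ofScalars h).hasFPowerSeriesAt
  have ha : AnalyticAt ℂ g 0 := ⟨_, hp⟩
  have := ha.hasFPowerSeriesAt.eq_formalMultilinearSeries hp
  exact congrFun (FormalMultilinearSeries.ofScalars_series_injective ℂ ℂ this) n

theorem hasSum_taylorCoeffZero {f : ℂ → ℂ} (hf : DifferentiableOn ℂ f (ball 0 1)) {z : ℂ}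
    (hz : z ∈ ball (0 : ℂ) 1) : HasSum (fun n => taylorCoeffZero f n * z ^ n) (f z) := by
  refine (Complex.hasSum_taylorSeries_on_ball hf hz).congr_fun fun n => ?_
  rw [taylorCoeffZero, sub_zero, smul_eq_mul, smul_eq_mul]
  ring

theorem lintegral_enorm_deriv_sq {f : ℂ → ℂ} (hf : DifferentiableOn ℂ f (ball 0 1)) :
    ∫⁻ z in ball (0 : ℂ) 1, ‖deriv f z‖ₑ ^ 2 =
      ∑' n : ℕ, ENNReal.ofReal (Real.pi * ((n + 1) * ‖taylorCoeffZero f (n + 1)‖ ^ 2)) := by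
  rw [lintegral_enorm_sq_ball (measurable_deriv f) _
    fun z hz => hasSum_taylorCoeffZero (hf.deriv isOpen_ball) hz]
  refine tsum_congr fun n => ?_
  have : taylorCoeffZero (deriv f) n = (n + 1) * taylorCoeffZero f (n + 1) := by
    rw [taylorCoeffZero, taylorCoeffZero, iteratedDeriv_succ', Nat.factorial_succ]
    have : (n + 1 : ℂ) ≠ 0 := by exact_mod_cast n.succ_ne_zero
    push_cast
    field_simp
  have hn : ‖(n + 1 : ℂ)‖ = n + 1 := by exact_mod_cast Complex.norm_natCast (n + 1)
  rw [this, norm_mul, hn]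
  congr 2
  field_simp

namespace DirichletSpace

theorem hasSum_norm_sq (f : DirichletSpace) :
    HasSum (fun n => dirichletWeight n * ‖taylorCoeffZero f n‖ ^ 2) (‖f‖ ^ 2) := by
  have h1 : ENNReal.ofReal (∫ z in ball (0 : ℂ) 1, ‖deriv f z‖ ^ 2) =
      ∑' n : ℕ, ENNReal.ofReal (Real.pi * ((n + 1) * ‖taylorCoeffZero f (n + 1)‖ ^ 2)) := by
    rw [← lintegral_enorm_deriv_sq f.2.1,
      ofReal_integral_eq_lintegral_ofReal f.2.2.1 (ae_of_all _ fun _ => by positivity)]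
    refine lintegral_congr fun z => ?_
    rw [ENNReal.ofReal_pow (norm_nonneg _), ofReal_norm]
  have h2 : HasSum (fun n : ℕ => Real.pi * ((n + 1) * ‖taylorCoeffZero f (n + 1)‖ ^ 2))
      (∫ z in ball (0 : ℂ) 1, ‖deriv f z‖ ^ 2) := by
    have := ENNReal.hasSum_toReal (h1 ▸ ENNReal.ofReal_ne_top)
    rw [← ENNReal.tsum_toReal_eq fun _ => ENNReal.ofReal_ne_top, ← h1,
      ENNReal.toReal_ofReal (integral_nonneg fun _ => by positivity)] at this
    refine this.congr_fun fun n => ?_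
    rw [ENNReal.toReal_ofReal (by positivity)]
  have h3 := h2.mul_left Real.pi⁻¹
  simp only [inv_mul_cancel_left₀ Real.pi_ne_zero] at h3
  rw [← hasSum_nat_add_iff' 1, norm_sq_eq]
  simpa [dirichletWeight, taylorCoeffZero] using h3

/-- Every weighted square summable sequence is the sequence of Taylor coefficients of an element
of the Dirichlet space. -/
theorem exists_taylorCoeffZero_eq {a : ℕ → ℂ}
    (ha : Summable fun n => dirichletWeight n * ‖a n‖ ^ 2) :
    ∃ f : DirichletSpace, ∀ n, taylorCoeffZero f n = a n := by
  have hbdd : ∀ n, ‖a n‖ ≤ Real.sqrt (∑' n, dirichletWeight n * ‖a n‖ ^ 2) := fun n => by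
    refine Real.le_sqrt_of_sq_le ?_
    have h1 := ha.le_tsum n fun m _ => mul_nonneg (dirichletWeight_pos m).le (by positivity)
    nlinarith [one_le_dirichletWeight n, sq_nonneg ‖a n‖]
  have hs : ∀ z ∈ ball (0 : ℂ) 1, Summable fun n => a n * z ^ n := fun z hz => by
    obtain ⟨C, hC⟩ : ∃ C, ∀ n, ‖a n‖ ≤ C := ⟨_, hbdd⟩
    have hgeo : Summable fun n => C * ‖z‖ ^ n :=
      (summable_geometric_of_lt_one (norm_nonneg z) (mem_ball_zero_iff.1 hz)).mul_left C
    refine hgeo.of_norm_bounded fun n => ?_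
    rw [norm_mul, norm_pow]
    exact mul_le_mul_of_nonneg_right (hC n) (by positivity)
  let g : ℂ → ℂ := (ball (0 : ℂ) 1).indicator fun z => ∑' n, a n * z ^ n
  have hg : ∀ z ∈ ball (0 : ℂ) 1, HasSum (fun n => a n * z ^ n) (g z) := fun z hz => by
    simp only [g, Set.indicator_of_mem hz]
    exact (hs z hz).hasSum
  have hgc := taylorCoeffZero_eq_of_hasSum hg
  have hgd : DifferentiableOn ℂ g (ball 0 1) := by
    have := (hasFPowerSeriesOnBall_ofScalars hg).differentiableOn
    rwa [← ENNReal.ofReal_one, Metric.eball_ofReal] at this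
  have hfin : ∫⁻ z in ball (0 : ℂ) 1, ‖deriv g z‖ₑ ^ 2 < ⊤ := by
    rw [lintegral_enorm_deriv_sq hgd]
    simp only [hgc]
    refine Summable.tsum_ofReal_lt_top (Summable.mul_left _ ?_)
    simpa [dirichletWeight] using (summable_nat_add_iff 1).2 ha
  refine ⟨⟨g, hgd, ?_, fun z hz => Set.indicator_of_notMem hz _⟩, hgc⟩
  refine ⟨((measurable_deriv g).norm.pow_const 2).aestronglyMeasurable, ?_⟩
  simpa [HasFiniteIntegral, enorm_pow] using hfin

theorem taylorCoeffZero_add (f g : DirichletSpace) (n : ℕ) :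
    taylorCoeffZero (f + g : DirichletSpace) n = taylorCoeffZero f n + taylorCoeffZero g n := by
  refine taylorCoeffZero_eq_of_hasSum (b := fun n => taylorCoeffZero f n + taylorCoeffZero g n)
    (fun z hz => ?_) n
  simp only [add_mul]
  exact (hasSum_taylorCoeffZero f.2.1 hz).add (hasSum_taylorCoeffZero g.2.1 hz)

theorem taylorCoeffZero_smul (c : ℂ) (f : DirichletSpace) (n : ℕ) :
    taylorCoeffZero (c • f : DirichletSpace) n = c * taylorCoeffZero f n := by
  refine taylorCoeffZero_eq_of_hasSum (b := fun n => c * taylorCoeffZero f n) (fun z hz => ?_) n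
  simp only [mul_assoc]
  exact (hasSum_taylorCoeffZero f.2.1 hz).mul_left c

/-- The isometry `f ↦ (√(max n 1) aₙ)` of the Dirichlet space onto `ℓ²`, where
`f(z) = ∑ aₙ zⁿ`. -/
noncomputable def equivLp : DirichletSpace ≃ₗᵢ[ℂ] lp (fun _ : ℕ => ℂ) 2 :=
  LinearIsometryEquiv.ofSurjective
    { toFun := fun f => ⟨fun n => (Real.sqrt (dirichletWeight n) : ℂ) * taylorCoeffZero f n,
        memℓp_gen (by
          simpa only [ENNReal.toReal_ofNat, Real.rpow_ofNat, norm_sqrt_dirichletWeight_mul_sq]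
            using f.hasSum_norm_sq.summable)⟩
      map_add' := fun f g => by
        ext n
        simp only [taylorCoeffZero_add, mul_add]
        rfl
      map_smul' := fun c f => by
        ext n
        simp [taylorCoeffZero_smul, mul_left_comm]
      norm_map' := fun f => by
        refine (sq_eq_sq₀ (norm_nonneg _) (norm_nonneg _)).1 ?_
        rw [← f.hasSum_norm_sq.tsum_eq]
        rw [lp_two_norm_sq_eq_tsum]
        refine tsum_congr fun n => ?_
        exact norm_sqrt_dirichletWeight_mul_sq n _ }
    fun b => by
      have hb : Summable fun n => ‖b n‖ ^ 2 := by
        simpa using (lp.memℓp b).summable (by norm_num)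
      obtain ⟨f, hf⟩ := exists_taylorCoeffZero_eq
        (a := fun n => ((Real.sqrt (dirichletWeight n) : ℝ) : ℂ)⁻¹ * b n) (by
          refine hb.congr fun n => ?_
          rw [← norm_sqrt_dirichletWeight_mul_sq, mul_inv_cancel_left₀]
          exact_mod_cast (Real.sqrt_pos.2 (dirichletWeight_pos n)).ne')
      refine ⟨f, ?_⟩
      ext n
      change (Real.sqrt (dirichletWeight n) : ℂ) * taylorCoeffZero f n = b n
      rw [hf, mul_inv_cancel_left₀]
      exact_mod_cast (Real.sqrt_pos.2 (dirichletWeight_pos n)).ne'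

theorem equivLp_apply (f : DirichletSpace) (n : ℕ) :
    equivLp f n = (Real.sqrt (dirichletWeight n) : ℂ) * taylorCoeffZero f n := rfl

end DirichletSpace

/-! ### Hankel matrices on the Dirichlet space -/

/-- In the orthonormal basis of normalized monomials the columns of the Hankel matrix are
`wₖ = (√(W n / W k) c (n + k))ₙ` with `W = dirichletWeight`. The diagonal `‖wₖ‖²` of their Gram
matrix tends to zero for every `c` with `∑ W n |c n|² < ∞`; hence the operator is compact as soon
as the off-diagonal part is square summable. -/
theorem hankelCompactOnDirichlet_of_summable_gram (c : ℕ → ℂ)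
    (hc : Summable fun n => dirichletWeight n * ‖c n‖ ^ 2)
    (hoff : Summable fun p : ℕ × ℕ => if p.1 = p.2 then 0 else
      ‖∑' n, (dirichletWeight n : ℂ) * (conj (c (n + p.1)) * c (n + p.2))‖ ^ 2 /
        (dirichletWeight p.1 * dirichletWeight p.2)) :
    HankelCompactOnDirichlet c := by
  have hsq : ∀ n, (Real.sqrt (dirichletWeight n) : ℂ) ≠ 0 := fun n => by
    exact_mod_cast (Real.sqrt_pos.2 (dirichletWeight_pos n)).ne'
  have hss : ∀ n, (Real.sqrt (dirichletWeight n) : ℂ) * Real.sqrt (dirichletWeight n) =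
      dirichletWeight n := fun n => by
    exact_mod_cast Real.mul_self_sqrt (dirichletWeight_pos n).le
  have hshift : ∀ k, Summable fun n => dirichletWeight (n + k) * ‖c (n + k)‖ ^ 2 := fun k =>
    (summable_nat_add_iff k).2 hc
  have hle : ∀ n k, dirichletWeight n * ‖c (n + k)‖ ^ 2 ≤
      dirichletWeight (n + k) * ‖c (n + k)‖ ^ 2 := fun n k =>
    mul_le_mul_of_nonneg_right (dirichletWeight_mono (Nat.le_add_right n k)) (by positivity)
  have hnn : ∀ n k, 0 ≤ dirichletWeight n * ‖c k‖ ^ 2 := fun n k =>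
    mul_nonneg (dirichletWeight_pos n).le (by positivity)
  have hcol : ∀ k, Summable fun n => dirichletWeight n * ‖c (n + k)‖ ^ 2 := fun k =>
    (hshift k).of_nonneg_of_le (fun n => hnn n _) fun n => hle n k
  have hentry : ∀ k n, ‖(Real.sqrt (dirichletWeight k) : ℂ)⁻¹ *
      ((Real.sqrt (dirichletWeight n) : ℂ) * c (n + k))‖ ^ 2 =
        dirichletWeight n * ‖c (n + k)‖ ^ 2 / dirichletWeight k := fun k n => by
    rw [norm_mul, mul_pow, norm_sqrt_dirichletWeight_mul_sq, norm_inv, inv_pow, Complex.norm_real,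
      Real.norm_of_nonneg (Real.sqrt_nonneg _), Real.sq_sqrt (dirichletWeight_pos k).le,
      inv_mul_eq_div]
  let w : ℕ → lp (fun _ : ℕ => ℂ) 2 := fun k =>
    ⟨fun n => (Real.sqrt (dirichletWeight k) : ℂ)⁻¹ *
        ((Real.sqrt (dirichletWeight n) : ℂ) * c (n + k)), by
      refine memℓp_gen ?_
      simp only [ENNReal.toReal_ofNat, Real.rpow_ofNat, hentry]
      exact (hcol k).div_const _⟩
  have hw : ∀ k n, w k n = (Real.sqrt (dirichletWeight k) : ℂ)⁻¹ *
        ((Real.sqrt (dirichletWeight n) : ℂ) * c (n + k)) := fun _ _ => rfl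
  have hnormw : ∀ k, ‖w k‖ ^ 2 ≤ (∑' n, dirichletWeight n * ‖c n‖ ^ 2) / dirichletWeight k :=
      fun k => by
    rw [lp_two_norm_sq_eq_tsum]
    simp only [hw, hentry]
    rw [tsum_div_const]
    refine div_le_div_of_nonneg_right ?_ (dirichletWeight_pos k).le
    refine ((hcol k).tsum_le_tsum (hle · k) (hshift k)).trans ?_
    exact tsum_comp_le_tsum_of_inj hc (fun n => hnn n n) (add_left_injective k)
  have hinner : ∀ j k, ‖inner ℂ (w j) (w k)‖ ^ 2 =
      ‖∑' n, (dirichletWeight n : ℂ) * (conj (c (n + j)) * c (n + k))‖ ^ 2 /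
        (dirichletWeight j * dirichletWeight k) := fun j k => by
    have h : ∀ n, inner ℂ (w j n) (w k n) =
        ((Real.sqrt (dirichletWeight j) : ℂ)⁻¹ * (Real.sqrt (dirichletWeight k) : ℂ)⁻¹) *
          ((dirichletWeight n : ℂ) * (conj (c (n + j)) * c (n + k))) := fun n => by
      rw [RCLike.inner_apply, hw, hw, ← hss n]
      simp only [map_mul, map_inv₀, Complex.conj_ofReal]
      ring
    rw [lp.inner_eq_tsum]
    simp only [h]
    rw [tsum_mul_left, norm_mul, mul_pow, norm_mul, mul_pow]
    simp only [norm_inv, Complex.norm_real, Real.norm_of_nonneg (Real.sqrt_nonneg _), inv_pow,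
      Real.sq_sqrt (dirichletWeight_pos _).le]
    rw [← mul_inv, inv_mul_eq_div]
  have hW : Tendsto dirichletWeight atTop atTop :=
    tendsto_atTop_mono (fun n => le_max_left (n : ℝ) 1) tendsto_natCast_atTop_atTop
  have hdiag : Tendsto (fun k => ‖w k‖) atTop (𝓝 0) := by
    have h2 : Tendsto (fun k => ‖w k‖ ^ 2) atTop (𝓝 0) :=
      squeeze_zero (fun k => by positivity) hnormw (hW.const_div_atTop _)
    simpa using h2.sqrt
  obtain ⟨S, hSc, hS⟩ := exists_isCompactOperator_of_gram w hdiag (by simpa only [hinner] using hoff)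
  refine ⟨(DirichletSpace.equivLp.symm : lp (fun _ : ℕ => ℂ) 2 →L[ℂ] DirichletSpace) ∘L S ∘L
    (DirichletSpace.equivLp : DirichletSpace →L[ℂ] lp (fun _ : ℕ => ℂ) 2), fun f => ?_, ?_⟩
  · set g : DirichletSpace := DirichletSpace.equivLp.symm (S (DirichletSpace.equivLp f)) with hg
    change IsHankelImage c f g
    refine ⟨fun n => taylorCoeffZero g n, fun n => ?_, fun z hz => hasSum_taylorCoeffZero g.2.1 hz⟩
    have h1 : S (DirichletSpace.equivLp f) n = (Real.sqrt (dirichletWeight n) : ℂ) *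
        taylorCoeffZero g n := by
      rw [← DirichletSpace.equivLp_apply, hg, LinearIsometryEquiv.apply_symm_apply]
    have h2 := ((hS (DirichletSpace.equivLp f)).mapL
      (lp.evalCLM ℂ (fun _ : ℕ => ℂ) 2 n)).mul_left (Real.sqrt (dirichletWeight n) : ℂ)⁻¹
    have h3 : HasSum (fun k => c (n + k) * taylorCoeffZero f k) (taylorCoeffZero g n) := by
      have h4 : (Real.sqrt (dirichletWeight n) : ℂ)⁻¹ * S (DirichletSpace.equivLp f) n =
          taylorCoeffZero g n := by
        rw [h1, inv_mul_cancel_left₀ (hsq n)]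
      rw [← h4]
      refine h2.congr_fun fun k => ?_
      change _ = _ * (DirichletSpace.equivLp f k * w k n)
      rw [DirichletSpace.equivLp_apply, hw]
      field_simp [hsq n, hsq k]
    exact h3.tendsto_sum_nat
  · exact (hSc.comp_clm
      (DirichletSpace.equivLp : DirichletSpace →L[ℂ] lp (fun _ : ℕ => ℂ) 2)).clm_comp
      (DirichletSpace.equivLp.symm : lp (fun _ : ℕ => ℂ) 2 →L[ℂ] DirichletSpace)

/-! ### Second moments of random Gram matrices -/

section Random

variable {Ω : Type*} [MeasurableSpace Ω] {P : Measure Ω}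

theorem integral_mul_mul_mul_eq_zero {ι : Type*} {X : ι → Ω → ℝ} (hmeas : ∀ n, Measurable (X n))
    (hindep : iIndepFun X P) (hmean : ∀ n, ∫ ω, X n ω ∂P = 0) {a b c d : ι} (hb : a ≠ b)
    (hc : a ≠ c) (hd : a ≠ d) : ∫ ω, X a ω * (X b ω * X c ω * X d ω) ∂P = 0 := by
  classical
  have h := hindep.indepFun_finset {a} {b, c, d} (by simp [hb, hc, hd]) hmeas
  have h' : IndepFun (X a) (fun ω => X b ω * X c ω * X d ω) P :=
    h.comp (φ := fun v : ({a} : Finset ι) → ℝ => v ⟨a, by simp⟩)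
      (ψ := fun v : ({b, c, d} : Finset ι) → ℝ =>
        v ⟨b, by simp⟩ * v ⟨c, by simp⟩ * v ⟨d, by simp⟩)
      (measurable_pi_apply _) (by fun_prop)
  have := h'.integral_fun_mul_eq_mul_integral
    (hmeas a).aestronglyMeasurable
    (((hmeas b).mul (hmeas c)).mul (hmeas d)).aestronglyMeasurable
  rw [this, hmean, zero_mul]

/-- For `j ≠ k` the products `X (n + j) * X (n + k)` are pairwise orthogonal in `L²`. -/
theorem integral_shift_mul_shift_eq_zero {X : ℕ → Ω → ℝ} (hmeas : ∀ n, Measurable (X n))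
    (hindep : iIndepFun X P) (hmean : ∀ n, ∫ ω, X n ω ∂P = 0) {j k n m : ℕ} (hjk : j ≠ k)
    (hnm : n ≠ m) : ∫ ω, X (n + j) ω * X (n + k) ω * (X (m + j) ω * X (m + k) ω) ∂P = 0 := by
  have key := fun {a b c d} => integral_mul_mul_mul_eq_zero hmeas hindep hmean
    (a := a) (b := b) (c := c) (d := d)
  -- the smallest of the four indices occurs only once
  rcases hnm.lt_or_gt with h | h <;> rcases hjk.lt_or_gt with h' | h'
  · rw [← key (a := n + j) (b := n + k) (c := m + j) (d := m + k) (by lia) (by lia) (by lia)]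
    exact integral_congr_ae (ae_of_all _ fun ω => by ring)
  · rw [← key (a := n + k) (b := n + j) (c := m + j) (d := m + k) (by lia) (by lia) (by lia)]
    exact integral_congr_ae (ae_of_all _ fun ω => by ring)
  · rw [← key (a := m + j) (b := n + k) (c := n + j) (d := m + k) (by lia) (by lia) (by lia)]
    exact integral_congr_ae (ae_of_all _ fun ω => by ring)
  · rw [← key (a := m + k) (b := n + k) (c := m + j) (d := n + j) (by lia) (by lia) (by lia)]
    exact integral_congr_ae (ae_of_all _ fun ω => by ring)

/-- The second moment of a linear combination with complex coefficients of orthogonal real random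
variables. -/
theorem lintegral_enorm_sq_sum_le {Y : ℕ → Ω → ℝ} (hY : ∀ n, MemLp (Y n) 2 P)
    (horth : ∀ n m, n ≠ m → ∫ ω, Y n ω * Y m ω ∂P = 0) {K : ℝ}
    (hK : ∀ n, ∫ ω, Y n ω ^ 2 ∂P ≤ K) (α : ℕ → ℂ) (s : Finset ℕ) :
    ∫⁻ ω, ‖∑ n ∈ s, α n * (Y n ω : ℂ)‖ₑ ^ 2 ∂P ≤ ∑ n ∈ s, ENNReal.ofReal (K * ‖α n‖ ^ 2) := by
  have hexp : ∀ ω, ‖∑ n ∈ s, α n * (Y n ω : ℂ)‖ ^ 2 =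
      ∑ n ∈ s, ∑ m ∈ s, (α n * conj (α m)).re * (Y n ω * Y m ω) := fun ω => by
    have : (((‖∑ n ∈ s, α n * (Y n ω : ℂ)‖ ^ 2 : ℝ)) : ℂ) =
        ∑ n ∈ s, ∑ m ∈ s, α n * conj (α m) * ((Y n ω * Y m ω : ℝ) : ℂ) := by
      rw [Complex.ofReal_pow, ← Complex.mul_conj', map_sum, Finset.sum_mul_sum]
      refine Finset.sum_congr rfl fun n _ => Finset.sum_congr rfl fun m _ => ?_
      rw [map_mul, Complex.conj_ofReal]
      push_cast
      ring
    have := congrArg Complex.re this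
    simpa only [Complex.ofReal_re, Complex.re_sum, Complex.re_mul_ofReal] using this
  have hi : ∀ n m, Integrable (fun ω => (α n * conj (α m)).re * (Y n ω * Y m ω)) P := fun n m =>
    ((hY n).integrable_mul (hY m)).const_mul _
  have hint : ∫ ω, ‖∑ n ∈ s, α n * (Y n ω : ℂ)‖ ^ 2 ∂P ≤ ∑ n ∈ s, K * ‖α n‖ ^ 2 := by
    simp only [hexp]
    rw [integral_finsetSum _ fun n _ => integrable_finsetSum _ fun m _ => hi n m]
    refine Finset.sum_le_sum fun n hn => ?_
    rw [integral_finsetSum _ fun m _ => hi n m, Finset.sum_eq_single n]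
    · rw [integral_const_mul, Complex.mul_conj, Complex.ofReal_re, Complex.normSq_eq_norm_sq,
        mul_comm K]
      simp only [← sq]
      exact mul_le_mul_of_nonneg_left (hK n) (by positivity)
    · intro m _ hmn
      rw [integral_const_mul, horth n m hmn.symm, mul_zero]
    · exact fun h => absurd hn h
  have hI : Integrable (fun ω => ‖∑ n ∈ s, α n * (Y n ω : ℂ)‖ ^ 2) P := by
    simp only [hexp]
    exact integrable_finsetSum _ fun n _ => integrable_finsetSum _ fun m _ => hi n m
  have hK0 : 0 ≤ K := (integral_nonneg fun ω => by positivity).trans (hK 0)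
  rw [← ENNReal.ofReal_sum_of_nonneg fun n _ => by positivity]
  refine le_trans (le_of_eq ?_) (ENNReal.ofReal_le_ofReal hint)
  rw [ofReal_integral_eq_lintegral_ofReal hI (ae_of_all _ fun _ => by positivity)]
  refine lintegral_congr fun ω => ?_
  rw [ENNReal.ofReal_pow (norm_nonneg _), ofReal_norm]

theorem memLp_two_mul_of_integrable_pow_four {f g : Ω → ℝ} (hf : Measurable f) (hg : Measurable g)
    (hf4 : Integrable (fun ω => f ω ^ 4) P) (hg4 : Integrable (fun ω => g ω ^ 4) P) :
    MemLp (fun ω => f ω * g ω) 2 P := by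
  rw [memLp_two_iff_integrable_sq (f := fun ω => f ω * g ω) (hf.mul hg).aestronglyMeasurable]
  refine (hf4.add hg4).mono' ((hf.mul hg).pow_const 2).aestronglyMeasurable
    (ae_of_all _ fun ω => ?_)
  rw [Real.norm_of_nonneg (by positivity), Pi.add_apply]
  nlinarith [sq_nonneg (f ω ^ 2 - g ω ^ 2), sq_nonneg (f ω ^ 2), sq_nonneg (g ω ^ 2)]

theorem tsum_tsum_tsum_shift_le (v q : ℕ → ENNReal) :
    ∑' j, ∑' k, ∑' n, v (n + j) * v (n + k) * (q j + q k) ≤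
      2 * ((∑' n, v n) ^ 2 * ∑' j, q j) := by
  have hshift : ∀ n, ∑' k, v (n + k) ≤ ∑' k, v k := fun n =>
    ENNReal.tsum_comp_le_tsum_of_injective (add_right_injective n) v
  have h : ∑' j, ∑' k, ∑' n, v (n + j) * v (n + k) * q j ≤ (∑' n, v n) ^ 2 * ∑' j, q j := by
    rw [← ENNReal.tsum_mul_left]
    refine ENNReal.tsum_le_tsum fun j => ?_
    rw [ENNReal.tsum_comm]
    simp only [ENNReal.tsum_mul_right, ENNReal.tsum_mul_left]
    rw [sq]
    gcongr
    calc ∑' n, v (n + j) * ∑' k, v (n + k) ≤ ∑' n, v (n + j) * ∑' k, v k := by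
          exact ENNReal.tsum_le_tsum fun n => mul_le_mul_right (hshift n) _
      _ ≤ _ := by
          rw [ENNReal.tsum_mul_right]
          refine mul_le_mul_left ?_ _
          simpa only [add_comm] using hshift j
  have h' : ∑' j, ∑' k, ∑' n, v (n + j) * v (n + k) * q k ≤ (∑' n, v n) ^ 2 * ∑' j, q j := by
    rw [ENNReal.tsum_comm]
    simpa only [mul_comm (v (_ + _)) (v (_ + _))] using h
  simp only [mul_add, ENNReal.tsum_add]
  rw [two_mul]
  exact add_le_add h h'

theorem summable_of_tsum_ofReal_ne_top {ι : Type*} {f : ι → ℝ} (hf : ∀ i, 0 ≤ f i)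
    (h : ∑' i, ENNReal.ofReal (f i) ≠ ⊤) : Summable f :=
  (ENNReal.summable_toReal h).congr fun i => ENNReal.toReal_ofReal (hf i)

theorem ae_tsum_ne_top {ι : Type*} [Countable ι] {f : ι → Ω → ENNReal}
    (hf : ∀ i, Measurable (f i)) (h : ∑' i, ∫⁻ ω, f i ω ∂P ≠ ⊤) : ∀ᵐ ω ∂P, ∑' i, f i ω ≠ ⊤ := by
  rw [← lintegral_tsum fun i => (hf i).aemeasurable] at h
  exact (ae_lt_top (Measurable.tsum hf) h).mono fun ω hω => hω.ne

theorem summable_inv_dirichletWeight_sq : Summable fun n => (dirichletWeight n ^ 2)⁻¹ := by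
  rw [← summable_nat_add_iff 1]
  have := (summable_nat_add_iff 1).2 (Real.summable_nat_pow_inv.2 one_lt_two)
  simpa [dirichletWeight] using this

theorem summable_dirichletWeight_of_powerSeriesMem {l : ℕ → ℂ} (hl : PowerSeriesMemDirichlet l) :
    Summable fun n => dirichletWeight n * ‖l n‖ ^ 2 := by
  obtain ⟨h, hh⟩ := hl
  simpa only [taylorCoeffZero_eq_of_hasSum hh] using h.hasSum_norm_sq.summable

/-- The elementary estimate `W(n)² / (W(j) W(k)) ≤ W(n + j) W(n + k) (W(j)⁻² + W(k)⁻²)` that makes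
the expected squared entries of the Gram matrix summable over `j`, `k` and `n`. -/
theorem norm_gram_coeff_sq_div_le (l : ℕ → ℂ) (j k n : ℕ) :
    ‖(dirichletWeight n : ℂ) * (l (n + j) * conj (l (n + k)))‖ ^ 2 /
        (dirichletWeight j * dirichletWeight k) ≤
      (dirichletWeight (n + j) * ‖l (n + j)‖ ^ 2) * (dirichletWeight (n + k) * ‖l (n + k)‖ ^ 2) *
        ((dirichletWeight j ^ 2)⁻¹ + (dirichletWeight k ^ 2)⁻¹) := by
  have hn := dirichletWeight_pos n
  have hj := dirichletWeight_pos j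
  have hk := dirichletWeight_pos k
  have h1 : dirichletWeight n * dirichletWeight n ≤
      dirichletWeight (n + j) * dirichletWeight (n + k) :=
    mul_le_mul (dirichletWeight_mono (Nat.le_add_right n j))
      (dirichletWeight_mono (Nat.le_add_right n k)) hn.le (dirichletWeight_pos _).le
  have h2 : (dirichletWeight j * dirichletWeight k)⁻¹ ≤
      (dirichletWeight j ^ 2)⁻¹ + (dirichletWeight k ^ 2)⁻¹ := by
    rw [mul_inv, ← inv_pow, ← inv_pow]
    nlinarith [sq_nonneg ((dirichletWeight j)⁻¹ - (dirichletWeight k)⁻¹),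
      sq_nonneg (dirichletWeight j)⁻¹, sq_nonneg (dirichletWeight k)⁻¹]
  rw [norm_mul, norm_mul, RCLike.norm_conj, Complex.norm_real, Real.norm_of_nonneg hn.le,
    div_eq_mul_inv]
  refine mul_le_mul ?_ h2 (by positivity)
    (mul_nonneg (mul_nonneg (dirichletWeight_pos _).le (by positivity))
      (mul_nonneg (dirichletWeight_pos _).le (by positivity)))
  calc (dirichletWeight n * (‖l (n + j)‖ * ‖l (n + k)‖)) ^ 2
      = dirichletWeight n * dirichletWeight n * (‖l (n + j)‖ ^ 2 * ‖l (n + k)‖ ^ 2) := by ring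
    _ ≤ dirichletWeight (n + j) * dirichletWeight (n + k) *
          (‖l (n + j)‖ ^ 2 * ‖l (n + k)‖ ^ 2) :=
        mul_le_mul_of_nonneg_right h1 (by positivity)
    _ = _ := by ring

/-- The random symbol almost surely has coefficients in the same weighted `ℓ²` space as `l`. -/
theorem ae_summable_dirichletWeight [IsProbabilityMeasure P] {l : ℕ → ℂ}
    (hl : Summable fun n => dirichletWeight n * ‖l n‖ ^ 2) {X : ℕ → Ω → ℝ}
    (hmeas : ∀ n, Measurable (X n)) (hfourth : ∀ n, Integrable (fun ω => X n ω ^ 4) P) {K : ℝ}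
    (hK : ∀ n, ∫ ω, X n ω ^ 4 ∂P = K) :
    ∀ᵐ ω ∂P, Summable fun n => dirichletWeight n * ‖(X n ω : ℂ) * conj (l n)‖ ^ 2 := by
  have hnn : ∀ n, 0 ≤ dirichletWeight n * ‖l n‖ ^ 2 := fun n =>
    mul_nonneg (dirichletWeight_pos n).le (by positivity)
  have heq : ∀ n ω, dirichletWeight n * ‖(X n ω : ℂ) * conj (l n)‖ ^ 2 =
      dirichletWeight n * ‖l n‖ ^ 2 * X n ω ^ 2 := fun n ω => by
    rw [norm_mul, RCLike.norm_conj, Complex.norm_real, mul_pow, Real.norm_eq_abs, sq_abs]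
    ring
  simp only [heq]
  have h1 : ∀ n, ∫⁻ ω, ENNReal.ofReal (dirichletWeight n * ‖l n‖ ^ 2 * X n ω ^ 2) ∂P ≤
      ENNReal.ofReal (dirichletWeight n * ‖l n‖ ^ 2 * (1 + K)) := fun n => by
    have hi : Integrable (fun ω => dirichletWeight n * ‖l n‖ ^ 2 * (1 + X n ω ^ 4)) P :=
      ((integrable_const 1).add (hfourth n)).const_mul _
    calc _ ≤ ∫⁻ ω, ENNReal.ofReal (dirichletWeight n * ‖l n‖ ^ 2 * (1 + X n ω ^ 4)) ∂P := by
          refine lintegral_mono fun ω => ENNReal.ofReal_le_ofReal ?_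
          refine mul_le_mul_of_nonneg_left ?_ (hnn n)
          nlinarith [sq_nonneg (X n ω ^ 2 - 1), sq_nonneg (X n ω)]
      _ = _ := by
          rw [← ofReal_integral_eq_lintegral_ofReal hi
            (ae_of_all _ fun ω => mul_nonneg (hnn n) (by positivity)), integral_const_mul,
            integral_add (integrable_const 1) (hfourth n), hK]
          simp
  have h2 : ∑' n, ∫⁻ ω, ENNReal.ofReal (dirichletWeight n * ‖l n‖ ^ 2 * X n ω ^ 2) ∂P ≠ ⊤ :=
    ne_top_of_le_ne_top (hl.mul_right (1 + K)).tsum_ofReal_ne_top (ENNReal.tsum_le_tsum h1)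
  filter_upwards [ae_tsum_ne_top (fun n => by have := hmeas n; fun_prop) h2] with ω hω
  exact summable_of_tsum_ofReal_ne_top (fun n => mul_nonneg (hnn n) (by positivity)) hω

/-- Second moment of an off-diagonal Gram entry. The entry appears as a lower limit of its partial
sums, which is measurable and to which Fatou's lemma applies without any convergence. -/
theorem lintegral_liminf_gram_le {X : ℕ → Ω → ℝ}
    (hmeas : ∀ n, Measurable (X n)) (hindep : iIndepFun X P) (hmean : ∀ n, ∫ ω, X n ω ∂P = 0)
    (hfourth : ∀ n, Integrable (fun ω => X n ω ^ 4) P) {K : ℝ}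
    (hK : ∀ n, ∫ ω, X n ω ^ 4 ∂P = K) {j k : ℕ} (hjk : j ≠ k) (α : ℕ → ℂ) :
    ∫⁻ ω, liminf (fun N => ‖∑ n ∈ Finset.range N,
        α n * ((X (n + j) ω * X (n + k) ω : ℝ) : ℂ)‖ₑ ^ 2) atTop ∂P ≤
      ∑' n, ENNReal.ofReal (K * ‖α n‖ ^ 2) := by
  refine (lintegral_liminf_le fun N => ?_).trans ?_
  · have := hmeas
    fun_prop
  refine (liminf_le_liminf (Eventually.of_forall fun N => (lintegral_enorm_sq_sum_le
    (fun n => memLp_two_mul_of_integrable_pow_four (hmeas _) (hmeas _) (hfourth _) (hfourth _))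
    (fun n m hnm => integral_shift_mul_shift_eq_zero hmeas hindep hmean hjk hnm) (K := K)
    (fun n => ?_) α (Finset.range N)).trans (ENNReal.sum_le_tsum _))).trans (by simp)
  have h : ∫ ω, (X (n + j) ω * X (n + k) ω) ^ 2 ∂P ≤
      ∫ ω, (X (n + j) ω ^ 4 + X (n + k) ω ^ 4) / 2 ∂P := by
    refine integral_mono ?_ (((hfourth _).add (hfourth _)).div_const 2) fun ω => ?_
    · exact (memLp_two_mul_of_integrable_pow_four (hmeas _) (hmeas _) (hfourth _)
        (hfourth _)).integrable_sq
    · nlinarith [sq_nonneg (X (n + j) ω ^ 2 - X (n + k) ω ^ 2)]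
  rw [integral_div, integral_add (hfourth _) (hfourth _), hK, hK] at h
  linarith

/-- The off-diagonal part of the random Gram matrix is almost surely Hilbert–Schmidt, because its
expected squared Hilbert–Schmidt norm is finite. -/
theorem ae_tsum_gram_ne_top {l : ℕ → ℂ} (hl : Summable fun n => dirichletWeight n * ‖l n‖ ^ 2)
    {X : ℕ → Ω → ℝ} (hmeas : ∀ n, Measurable (X n)) (hindep : iIndepFun X P)
    (hmean : ∀ n, ∫ ω, X n ω ∂P = 0) (hfourth : ∀ n, Integrable (fun ω => X n ω ^ 4) P) {K : ℝ}
    (hK : ∀ n, ∫ ω, X n ω ^ 4 ∂P = K) :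
    ∀ᵐ ω ∂P, ∑' p : ℕ × ℕ, (if p.1 = p.2 then 0 else
      liminf (fun N => ‖∑ n ∈ Finset.range N,
        (dirichletWeight n : ℂ) * (l (n + p.1) * conj (l (n + p.2))) *
          ((X (n + p.1) ω * X (n + p.2) ω : ℝ) : ℂ)‖ₑ ^ 2) atTop *
        ENNReal.ofReal (dirichletWeight p.1 * dirichletWeight p.2)⁻¹) ≠ ⊤ := by
  have hK0 : 0 ≤ K := by
    rw [← hK 0]
    exact integral_nonneg fun ω => by positivity
  have hmeasS : ∀ p : ℕ × ℕ, Measurable fun ω => liminf (fun N => ‖∑ n ∈ Finset.range N,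
      (dirichletWeight n : ℂ) * (l (n + p.1) * conj (l (n + p.2))) *
        ((X (n + p.1) ω * X (n + p.2) ω : ℝ) : ℂ)‖ₑ ^ 2) atTop := fun p => by
    refine Measurable.liminf fun N => ?_
    have := hmeas
    fun_prop
  refine ae_tsum_ne_top (fun p => ?_) ?_
  · split_ifs
    · exact measurable_const
    · exact (hmeasS p).mul_const _
  set v : ℕ → ENNReal := fun n => ENNReal.ofReal (dirichletWeight n * ‖l n‖ ^ 2) with hv
  set q : ℕ → ENNReal := fun n => ENNReal.ofReal (dirichletWeight n ^ 2)⁻¹ with hq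
  have hvn : ∀ n, 0 ≤ dirichletWeight n * ‖l n‖ ^ 2 := fun n =>
    mul_nonneg (dirichletWeight_pos n).le (by positivity)
  have hfin : ENNReal.ofReal K * (2 * ((∑' n, v n) ^ 2 * ∑' j, q j)) ≠ ⊤ := by
    have h1 : ∑' n, v n ≠ ⊤ := hl.tsum_ofReal_ne_top
    have h2 : ∑' n, q n ≠ ⊤ := summable_inv_dirichletWeight_sq.tsum_ofReal_ne_top
    finiteness
  refine ne_top_of_le_ne_top hfin (le_trans ?_ (mul_le_mul_right (tsum_tsum_tsum_shift_le v q) _))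
  rw [ENNReal.tsum_prod']
  simp only [← ENNReal.tsum_mul_left]
  refine ENNReal.tsum_le_tsum fun j => ENNReal.tsum_le_tsum fun k => ?_
  by_cases hjk : j = k
  · simp [hjk]
  simp only [if_neg hjk]
  rw [lintegral_mul_const _ (hmeasS (j, k))]
  refine (mul_le_mul_left (lintegral_liminf_gram_le hmeas hindep hmean hfourth hK hjk _) _).trans ?_
  rw [← ENNReal.tsum_mul_right]
  refine ENNReal.tsum_le_tsum fun n => ?_
  have hpos : ∀ n, 0 ≤ (dirichletWeight n ^ 2)⁻¹ := fun n => by positivity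
  rw [hv, hq, ← ENNReal.ofReal_add (hpos j) (hpos k), ← ENNReal.ofReal_mul (hvn _),
    ← ENNReal.ofReal_mul (mul_nonneg (hvn _) (hvn _)), ← ENNReal.ofReal_mul hK0,
    ← ENNReal.ofReal_mul (by positivity)]
  refine ENNReal.ofReal_le_ofReal ?_
  rw [mul_assoc, ← div_eq_mul_inv]
  exact mul_le_mul_of_nonneg_left (norm_gram_coeff_sq_div_le l j k n) hK0

theorem summable_dirichletWeight_mul_conj {c : ℕ → ℂ}
    (hc : Summable fun n => dirichletWeight n * ‖c n‖ ^ 2) (j k : ℕ) :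
    Summable fun n => (dirichletWeight n : ℂ) * (conj (c (n + j)) * c (n + k)) := by
  refine (((summable_nat_add_iff j).2 hc).add ((summable_nat_add_iff k).2 hc)).of_norm_bounded
    fun n => ?_
  rw [norm_mul, norm_mul, RCLike.norm_conj, Complex.norm_real,
    Real.norm_of_nonneg (dirichletWeight_pos n).le]
  have h1 := mul_le_mul_of_nonneg_right (dirichletWeight_mono (Nat.le_add_right n j))
    (sq_nonneg ‖c (n + j)‖)
  have h2 := mul_le_mul_of_nonneg_right (dirichletWeight_mono (Nat.le_add_right n k))
    (sq_nonneg ‖c (n + k)‖)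
  have h3 : ‖c (n + j)‖ * ‖c (n + k)‖ ≤ ‖c (n + j)‖ ^ 2 + ‖c (n + k)‖ ^ 2 := by
    nlinarith [sq_nonneg (‖c (n + j)‖ - ‖c (n + k)‖), sq_nonneg ‖c (n + j)‖,
      sq_nonneg ‖c (n + k)‖]
  linarith [mul_le_mul_of_nonneg_left h3 (dirichletWeight_pos n).le]

end Random

/-! ### Random Hankel operators -/

theorem theorem1p4 {Ω : Type*} [MeasurableSpace Ω] (P : Measure Ω) [IsProbabilityMeasure P]
    (l : ℕ → ℂ) (X : ℕ → Ω → ℝ)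
    (hmeas : ∀ n, Measurable (X n))
    (hindep : iIndepFun X P)
    (hident : ∀ n, IdentDistrib (X n) (X 0) P P)
    (hmean : ∀ n, ∫ ω, X n ω ∂P = 0)
    (hfourth : ∀ n, Integrable (fun ω => X n ω ^ 4) P)
    (hl : PowerSeriesMemDirichlet l) :
    ∀ᵐ ω ∂P, HankelCompactOnDirichlet (fun n => (X n ω : ℂ) * conj (l n)) := by
  have hu := summable_dirichletWeight_of_powerSeriesMem hl
  have hK : ∀ n, ∫ ω, X n ω ^ 4 ∂P = ∫ ω, X 0 ω ^ 4 ∂P := fun n =>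
    ((hident n).comp (measurable_id.pow_const 4)).integral_eq
  filter_upwards [ae_summable_dirichletWeight hu hmeas hfourth hK,
    ae_tsum_gram_ne_top hu hmeas hindep hmean hfourth hK] with ω hc hG
  refine hankelCompactOnDirichlet_of_summable_gram _ hc (summable_of_tsum_ofReal_ne_top
    (fun p => ?_) ?_)
  · have h1 := dirichletWeight_pos p.1
    have h2 := dirichletWeight_pos p.2
    split_ifs <;> positivity
  · convert hG using 3 with p
    by_cases hp : p.1 = p.2
    · simp [hp]
    simp only [if_neg hp]
    have ht := (summable_dirichletWeight_mul_conj hc p.1 p.2).hasSum.tendsto_sum_nat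
    rw [div_eq_mul_inv, ENNReal.ofReal_mul (by positivity), ENNReal.ofReal_pow (norm_nonneg _),
      ofReal_norm]
    congr 1
    have := (((ENNReal.continuous_pow 2).tendsto _).comp
      ((continuous_enorm.tendsto _).comp ht)).liminf_eq
    rw [← this]
    refine congrArg (fun f => liminf f atTop) (funext fun N => ?_)
    simp only [Function.comp_apply]
    congr 2
    refine Finset.sum_congr rfl fun n _ => ?_
    rw [map_mul, Complex.conj_conj, Complex.conj_ofReal]
    push_cast
    ring
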